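/- Let $Y=(Y_t)_{t\ge 0}$ be a time-homogeneous continuous-time Markov chain with right-continuous paths on a finite state space $\mathbb{S}\subset\mathbb{R}$, with transition rate matrix $G$, i.e. $G(x,y)\ge 0$ for $x\neq y$, $G(x,x)=-\sum_{y\ne x}G(x,y)$, and $\mathbb{P}_x[Y_t=y]=1_{\{x=y\}}+G(x,y)t+o(t)$ as $t\downarrow 0$. Here $\mathbb{P}_x$ and $\mathbb{E}_x$ refer to the chain started from $Y_0=x$. Let $L\in\mathbb{R}$, $D>0$ and $f:\mathbb{S}\to\mathbb{R}$. With $g^-_{L,t}=\sup\{s\le t: Y_s\ge L\}$ and the conventions $\sup\emptyset=0$, $\inf\emptyset=\infty$, let $$\tau=\tau^-_{L,D}=\inf\{t\ge 0:\ 1_{\{Y_t<L\}}(t-g^-_{L,t})\ge D\}$$ be the first time that the age of an excursion of $Y$ below $L$ reaches $D$. For $\Re(q)>0$ and $x,z\in\mathbb{S}$ put $$h(q,x;z)=\mathbb{E}_x\left[e^{-q\tau}1_{\{Y_\tau=z\}}\right]$$ (the integrand being $0$ on $\{\tau=\infty\}$), and let $u(t,x)=\mathbb{E}_x\left[1_{\{\tau\le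 t\}}f(Y_t)\right]$ be the price of the down-and-in Parisian option with maturity $t$ and payoff $f$. Then for every $q\in\mathbb{C}$ with $\Re(q)>0$ and every $x\in\mathbb{S}$, the expectations and integrals below converge absolutely and $$\int_0^\infty e^{-qt}u(t,x)\,dt=\sum_{z\in\mathbb{S},\,z<L}h(q,x;z)\,\widetilde w(q,z),\qquad \widetilde w(q,z)=\int_0^\infty e^{-qt}\,\mathbb{E}_z[f(Y_t)]\,dt.$$ The Laplace transform $\widetilde w(q,\cdot)$ of the European option price satisfies the linear system $$q\,\widetilde w(q,z)-\sum_{y\in\mathbb{S}}G(z,y)\,\widetilde w(q,y)=f(z),\qquad z\in\mathbb{S};$$ moreover $qI-G$ is invertible, so that $\widetilde w(q,\cdot)=(qI-G)^{-1}f$. -/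

import Mathlib

open MeasureTheory Filter Topology
open scoped NNReal ENNReal

noncomputable section

/-! ### Parisian stopping times of a real path -/

/-- `g⁻_{L,t} = sup {s ≤ t : X_s ≥ L}`, the last time up to `t` at which the path `X` is at or
above `L`.  In `ℝ≥0` the supremum of the empty set is `0`. -/
def lastTimeAtOrAbove (L : ℝ) (X : ℝ≥0 → ℝ) (t : ℝ≥0) : ℝ≥0 :=
  sSup {s : ℝ≥0 | s ≤ t ∧ L ≤ X s}

/-- `1_{X_t < L} (t - g⁻_{L,t})`, the age at time `t` of the excursion of `X` below `L`. -/
def excursionAgeBelow (L : ℝ) (X : ℝ≥0 → ℝ) (t : ℝ≥0) : ℝ :=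
  if X t < L then (t : ℝ) - (lastTimeAtOrAbove L X t : ℝ) else 0

/-- `τ⁻_{L,D} = inf {t ≥ 0 : 1_{X_t < L} (t - g⁻_{L,t}) ≥ D}`, with `inf ∅ = ∞`. -/
def parisianTimeBelow (L D : ℝ) (X : ℝ≥0 → ℝ) : ℝ≥0∞ :=
  sInf {r : ℝ≥0∞ | ∃ t : ℝ≥0, r = (t : ℝ≥0∞) ∧ D ≤ excursionAgeBelow L X t}

/-! ### Finite-state continuous time Markov chains -/

/-- Transition rate matrices on a finite set of states. -/
structure IsRateMatrix {S : Finset ℝ} (G : Matrix S S ℝ) : Prop where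
  offDiag_nonneg : ∀ x y : S, x ≠ y → 0 ≤ G x y
  diag_eq : ∀ x : S, G x x = -∑ y ∈ Finset.univ.erase x, G x y

/-- The information generated by the process `Y` up to time `s`. -/
@[reducible] def pastOf {S : Finset ℝ} {Ω : Type*} (Y : ℝ≥0 → Ω → S) (s : ℝ≥0) : MeasurableSpace Ω :=
  ⨆ u : ℝ≥0, ⨆ _ : u ≤ s, MeasurableSpace.comap (Y u) inferInstance

/-- `Y`, with the family `(P x)` of laws of the process started from `x`, is a time-homogeneous
continuous time Markov chain on the finite set `S ⊆ ℝ` with transition rate matrix `G`: it has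
right-continuous paths, it has the Markov property with respect to its own past, and
`P_x (Y_t = y) = 1_{x = y} + G(x, y) t + o(t)` as `t ↓ 0`. -/
structure IsCTMC {S : Finset ℝ} {Ω : Type*} [MeasurableSpace Ω]
    (G : Matrix S S ℝ) (P : S → Measure Ω) (Y : ℝ≥0 → Ω → S) : Prop where
  isProbabilityMeasure : ∀ x : S, IsProbabilityMeasure (P x)
  isRateMatrix : IsRateMatrix G
  measurable : ∀ t : ℝ≥0, Measurable (Y t)
  rightContinuous : ∀ (ω : Ω) (t : ℝ≥0),
    ContinuousWithinAt (fun s : ℝ≥0 => Y s ω) (Set.Ici t) t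
  start : ∀ x : S, ∀ᵐ ω ∂(P x), Y 0 ω = x
  markov : ∀ (x : S) (s t : ℝ≥0) (A : Set Ω), MeasurableSet[pastOf Y s] A → ∀ y z : S,
    (P x).real (A ∩ {ω | Y s ω = y} ∩ {ω | Y (s + t) ω = z}) =
      (P x).real (A ∩ {ω | Y s ω = y}) * (P y).real {ω | Y t ω = z}
  rate : ∀ x y : S,
    Tendsto (fun t : ℝ≥0 => ((P x).real {ω | Y t ω = y} - (if x = y then 1 else 0)) / (t : ℝ))
      (𝓝[>] 0) (𝓝 (G x y))

/-! ### The quantities of the pricing problem -/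

section

variable {S : Finset ℝ} {Ω : Type*} [MeasurableSpace Ω]

/-- The Parisian time `τ⁻_{L,D}` of the process `Y`. -/
def parisianTime (L D : ℝ) (Y : ℝ≥0 → Ω → S) (ω : Ω) : ℝ≥0∞ :=
  parisianTimeBelow L D (fun s => (Y s ω : ℝ))

/-- The random variable `e^{-q τ} 1_{Y_τ = z}`, `τ = τ⁻_{L,D}`, equal to `0` where `τ = ∞`. -/
def discountedHit (L D : ℝ) (Y : ℝ≥0 → Ω → S) (q : ℂ) (z : S) (ω : Ω) : ℂ :=
  if parisianTime L D Y ω ≠ ⊤ ∧ Y (parisianTime L D Y ω).toNNReal ω = z then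
    Complex.exp (-q * ((parisianTime L D Y ω).toReal : ℂ)) else 0

/-- `h(q, x; z) = E_x [e^{-q τ} 1_{Y_τ = z}]`, `τ = τ⁻_{L,D}`. -/
def parisianTransform (P : S → Measure Ω) (Y : ℝ≥0 → Ω → S) (L D : ℝ) (q : ℂ) (x z : S) : ℂ :=
  ∫ ω, discountedHit L D Y q z ω ∂(P x)

/-- The payoff `1_{τ ≤ t} f(Y_t)`, `τ = τ⁻_{L,D}`, of the down-and-in Parisian option. -/
def downInPayoff (L D : ℝ) (Y : ℝ≥0 → Ω → S) (f : S → ℝ) (t : ℝ≥0) (ω : Ω) : ℝ :=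
  if parisianTime L D Y ω ≤ (t : ℝ≥0∞) then f (Y t ω) else 0

/-- `u(t, x) = E_x [1_{τ ≤ t} f(Y_t)]`, the down-and-in Parisian option price. -/
def downInPrice (P : S → Measure Ω) (Y : ℝ≥0 → Ω → S) (L D : ℝ) (f : S → ℝ)
    (t : ℝ≥0) (x : S) : ℝ :=
  ∫ ω, downInPayoff L D Y f t ω ∂(P x)

/-- `E_z [f(Y_t)]`, the European option price. -/
def europeanPrice (P : S → Measure Ω) (Y : ℝ≥0 → Ω → S) (f : S → ℝ) (t : ℝ≥0) (z : S) : ℝ :=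
  ∫ ω, f (Y t ω) ∂(P z)

end

/-- The integrand `e^{-q t} u(t)` of the Laplace transform. -/
def laplaceIntegrand (u : ℝ≥0 → ℝ) (q : ℂ) (t : ℝ) : ℂ :=
  Complex.exp (-q * (t : ℂ)) * (u t.toNNReal : ℂ)

/-- The Laplace transform `∫₀^∞ e^{-q t} u(t) dt`. -/
def laplaceTransform (u : ℝ≥0 → ℝ) (q : ℂ) : ℂ :=
  ∫ t in Set.Ioi (0 : ℝ), laplaceIntegrand u q t

end

/-! Before `τ` the payoff vanishes; after `τ` the option is a European one started from `Y_τ`.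
Shifting time by `τ` factors the pathwise Laplace integral as `e^{-qτ}` times the transform of `s ↦
f(Y_{τ+s})`. Fubini and the strong Markov property then replace `f(Y_{τ+s})` by the European price
at `Y_τ`, and splitting over the finitely many values of `Y_τ` gives the sum; states `z ≥ L` drop
out because the path is below `L` at `τ`.

The strong Markov property (`setIntegral_parisianTime`) is derived from the simple one. Since the
state space is discrete, right-continuous paths are locally constant from the right. Hence `{τ < b}`
depends on countably many times and lies in the past of `b` (`measurableSet_parisianTime_lt`).
Replacing `τ` by the next grid point gives countably many deterministic times, and refining the grid
recovers `τ` from the right.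

For the linear system, Chapman-Kolmogorov together with a shift of the Laplace integral gives `P_h w
= e^{qh} (w - ∫₀^h e^{-qt} E[f(Y_t)] dt)`. Its derivative at `h = 0+` is `G w = q w - f`. Indicator
payoffs then produce a right inverse of `qI - G`. -/

/-! ### Approximation of times from above by a grid -/

/-- The `k`-th positive point of the grid of mesh `1 / (n + 1)`. -/
noncomputable def gridPoint (n k : ℕ) : ℝ≥0 := (k + 1) / (n + 1)

/-- The first point of the grid of mesh `1 / (n + 1)` that is strictly later than `t`. -/
noncomputable def gridAbove (n : ℕ) (t : ℝ≥0) : ℝ≥0 := gridPoint n ⌊t * (n + 1)⌋₊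

theorem lt_gridAbove (n : ℕ) (t : ℝ≥0) : t < gridAbove n t := by
  unfold gridAbove gridPoint
  rw [lt_div_iff₀ (by positivity)]
  exact Nat.lt_floor_add_one _

theorem gridAbove_le (n : ℕ) (t : ℝ≥0) : gridAbove n t ≤ t + 1 / (n + 1) := by
  unfold gridAbove gridPoint
  rw [add_div]
  gcongr
  rw [div_le_iff₀ (by positivity)]
  exact Nat.floor_le (by positivity)

theorem tendsto_gridAbove (t : ℝ≥0) :
    Tendsto (fun n => gridAbove n t) atTop (𝓝[≥] t) := by
  refine tendsto_nhdsWithin_iff.2 ⟨?_, Eventually.of_forall fun n => (lt_gridAbove n t).le⟩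
  refine tendsto_of_tendsto_of_tendsto_of_le_of_le tendsto_const_nhds ?_
    (fun n => (lt_gridAbove n t).le) (fun n => gridAbove_le n t)
  simpa using (tendsto_const_nhds (x := t)).add (tendsto_one_div_add_atTop_nhds_zero_nat (𝕜 := ℝ≥0))

/-- Phrased with strict upper bounds and their negations only, since the events shown to belong to
the past are those of the form `{τ < b}`. -/
theorem floor_mul_eq_iff (n k : ℕ) (t : ℝ≥0) :
    ⌊t * (n + 1)⌋₊ = k ↔ ¬ t < (k : ℝ≥0) / (n + 1) ∧ t < gridPoint n k := by
  unfold gridPoint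
  rw [Nat.floor_eq_iff (by positivity), not_lt,
    lt_div_iff₀ (by positivity), div_le_iff₀ (by positivity)]

/-! ### Parisian times of a path -/

/-- Removes the supremum: the path must stay below `L` on the window `(t - D, t]`. The bound `D ≤ t`
reflects the convention `sup ∅ = 0`, and `D > 0` rules out the branch where the age is `0`. -/
theorem le_excursionAgeBelow_iff {L D : ℝ} (hD : 0 < D) (X : ℝ≥0 → ℝ) (t : ℝ≥0) :
    D ≤ excursionAgeBelow L X t ↔
      D.toNNReal ≤ t ∧ ∀ u ≤ t, t < u + D.toNNReal → X u < L := by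
  have hD' : (D.toNNReal : ℝ) = D := Real.coe_toNNReal _ hD.le
  have hDp : 0 < D.toNNReal := Real.toNNReal_pos.2 hD
  have hb : BddAbove {s : ℝ≥0 | s ≤ t ∧ L ≤ X s} := ⟨t, fun s hs => hs.1⟩
  unfold excursionAgeBelow
  constructor
  · intro h
    split_ifs at h with ht
    · have h1 : lastTimeAtOrAbove L X t + D.toNNReal ≤ t := by
        rw [← NNReal.coe_le_coe]; push_cast; rw [hD']; linarith
      refine ⟨le_trans le_add_self h1, fun u hu htu => ?_⟩
      by_contra hL
      have : u ≤ lastTimeAtOrAbove L X t := le_csSup hb ⟨hu, not_lt.1 hL⟩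
      exact absurd (htu.trans_le ((by gcongr : u + D.toNNReal ≤ _).trans h1)) (lt_irrefl _)
    · linarith
  · rintro ⟨h1, h2⟩
    rw [if_pos (h2 t le_rfl (lt_add_of_pos_right _ hDp))]
    have h3 : lastTimeAtOrAbove L X t ≤ t - D.toNNReal := by
      refine csSup_le' fun u hu => ?_
      by_contra hlt
      rw [not_le, tsub_lt_iff_right h1] at hlt
      exact absurd (h2 u hu.1 hlt) (not_lt.2 hu.2)
    rw [← NNReal.coe_le_coe, NNReal.coe_sub h1, hD'] at h3
    linarith

theorem parisianTimeBelow_lt_iff (L D : ℝ) (X : ℝ≥0 → ℝ) (b : ℝ≥0∞) :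
    parisianTimeBelow L D X < b ↔ ∃ t : ℝ≥0, (t : ℝ≥0∞) < b ∧ D ≤ excursionAgeBelow L X t := by
  unfold parisianTimeBelow
  rw [sInf_lt_iff]
  constructor
  · rintro ⟨_, ⟨t, rfl, h⟩, hb⟩
    exact ⟨t, hb, h⟩
  · rintro ⟨t, hb, h⟩
    exact ⟨t, ⟨t, rfl, h⟩, hb⟩

theorem parisianTimeBelow_le (L D : ℝ) (X : ℝ≥0 → ℝ) {t : ℝ≥0}
    (h : D ≤ excursionAgeBelow L X t) : parisianTimeBelow L D X ≤ t :=
  sInf_le ⟨t, rfl, h⟩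

/-- A path that is locally constant from the right. -/
def IsRightLocallyConstant {E : Type*} (X : ℝ≥0 → E) : Prop :=
  ∀ t, ∀ᶠ s in 𝓝[≥] t, X s = X t

theorem IsRightLocallyConstant.exists_gt {E : Type*} {X : ℝ≥0 → E}
    (hX : IsRightLocallyConstant X) (t : ℝ≥0) : ∃ u > t, ∀ s, t ≤ s → s < u → X s = X t := by
  obtain ⟨u, hu, h⟩ := mem_nhdsGE_iff_exists_Ico_subset.1 (hX t)
  exact ⟨u, hu, fun s h1 h2 => h ⟨h1, h2⟩⟩

/-- For a path which is locally constant from the right, ages of excursions need only be inspected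
at the times of a dense sequence. -/
theorem parisianTimeBelow_lt_iff_denseSeq {L D : ℝ} (hD : 0 < D) {X : ℝ≥0 → ℝ}
    (hX : IsRightLocallyConstant X) (b : ℝ≥0) :
    parisianTimeBelow L D X < b ↔
      ∃ i, TopologicalSpace.denseSeq ℝ≥0 i < b ∧
        D.toNNReal ≤ TopologicalSpace.denseSeq ℝ≥0 i ∧
        X (TopologicalSpace.denseSeq ℝ≥0 i) < L ∧
        ∀ j, TopologicalSpace.denseSeq ℝ≥0 j < TopologicalSpace.denseSeq ℝ≥0 i →
          TopologicalSpace.denseSeq ℝ≥0 i < TopologicalSpace.denseSeq ℝ≥0 j + D.toNNReal →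
          X (TopologicalSpace.denseSeq ℝ≥0 j) < L := by
  have hDp : 0 < D.toNNReal := Real.toNNReal_pos.2 hD
  have between : ∀ s t : ℝ≥0, s < t → ∃ i, s < TopologicalSpace.denseSeq ℝ≥0 i ∧
      TopologicalSpace.denseSeq ℝ≥0 i < t := fun s t hst => by
    obtain ⟨_, ⟨i, rfl⟩, h⟩ := (TopologicalSpace.denseRange_denseSeq ℝ≥0).exists_between hst
    exact ⟨i, h.1, h.2⟩
  rw [parisianTimeBelow_lt_iff]
  simp only [le_excursionAgeBelow_iff hD, ENNReal.coe_lt_coe]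
  constructor
  · rintro ⟨t, htb, hDt, ht⟩
    obtain ⟨v, hv, hcv⟩ := hX.exists_gt t
    -- Moving `t` slightly to the right is harmless: the window of the new time only adds points of
    -- `[t, v)`, where the path still has the value `X t`.
    obtain ⟨i, hi1, hi2⟩ := between t (min v b) (lt_min hv htb)
    have key : ∀ u ≤ TopologicalSpace.denseSeq ℝ≥0 i,
        TopologicalSpace.denseSeq ℝ≥0 i < u + D.toNNReal → X u < L := by
      intro u hu hiu
      rcases le_total u t with hut | htu
      · exact ht u hut (hi1.trans hiu)
      · rw [hcv u htu (hu.trans_lt (hi2.trans_le (min_le_left _ _)))]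
        exact ht t le_rfl (lt_add_of_pos_right _ hDp)
    exact ⟨i, hi2.trans_le (min_le_right _ _), hDt.trans hi1.le,
      key _ le_rfl (lt_add_of_pos_right _ hDp), fun j hj hij => key _ hj.le hij⟩
  · rintro ⟨i, hib, hDi, hi, hj⟩
    refine ⟨_, hib, hDi, fun u hu hiu => ?_⟩
    rcases hu.eq_or_lt with rfl | hu
    · exact hi
    obtain ⟨v, hv, hcv⟩ := hX.exists_gt u
    -- A sample just to the right of `u` has the value `X u` and stays in the window, which is open
    -- on the left. At the right end there is no room for this, whence the separate clause on `X` at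
    -- the sample `i`.
    obtain ⟨j, hj1, hj2⟩ := between u (min v _) (lt_min hv hu)
    rw [← hcv _ hj1.le (hj2.trans_le (min_le_left _ _))]
    exact hj j (hj2.trans_le (min_le_right _ _)) (hiu.trans (by gcongr))

/-- The path is below the level at its Parisian time. -/
theorem lt_at_parisianTimeBelow {L D : ℝ} (hD : 0 < D) {X : ℝ≥0 → ℝ}
    (hX : IsRightLocallyConstant X) (h : parisianTimeBelow L D X ≠ ⊤) :
    X (parisianTimeBelow L D X).toNNReal < L := by
  have hDp : 0 < D.toNNReal := Real.toNNReal_pos.2 hD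
  -- Attainment of the infimum is not needed: some time of age at least `D` lies in `[τ, v)`, where
  -- the path has the value it takes at `τ`.
  obtain ⟨v, hv, hcv⟩ := hX.exists_gt (parisianTimeBelow L D X).toNNReal
  have hlt : parisianTimeBelow L D X < v := by
    rwa [← ENNReal.coe_toNNReal h, ENNReal.coe_lt_coe]
  obtain ⟨t, ht, hage⟩ := (parisianTimeBelow_lt_iff L D X v).1 hlt
  rw [← hcv t (ENNReal.toNNReal_mono ENNReal.coe_ne_top (parisianTimeBelow_le L D X hage))
    (ENNReal.coe_lt_coe.1 ht)]
  exact ((le_excursionAgeBelow_iff hD X t).1 hage).2 t le_rfl (lt_add_of_pos_right _ hDp)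

/-! ### Measurability -/

theorem measurableSet_pastOf {S : Finset ℝ} {Ω : Type*} {Y : ℝ≥0 → Ω → S} {s u : ℝ≥0} (h : u ≤ s) (B : Set S) :
    MeasurableSet[pastOf Y s] {ω | Y u ω ∈ B} :=
  (le_iSup₂ (f := fun u (_ : u ≤ s) => MeasurableSpace.comap (Y u) inferInstance) u h) _
    ⟨B, B.toFinite.measurableSet, rfl⟩

namespace IsCTMC

variable {S : Finset ℝ} {Ω : Type*} [MeasurableSpace Ω] {G : Matrix S S ℝ} {P : S → Measure Ω}
  {Y : ℝ≥0 → Ω → S}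

theorem isRightLocallyConstant (hY : IsCTMC G P Y) (ω : Ω) :
    IsRightLocallyConstant (fun t => Y t ω) := fun t =>
  (hY.rightContinuous ω t) ((isOpen_discrete {Y t ω}).mem_nhds rfl)

theorem isRightLocallyConstant_coe (hY : IsCTMC G P Y) (ω : Ω) :
    IsRightLocallyConstant (fun t => (Y t ω : ℝ)) := fun t =>
  (hY.isRightLocallyConstant ω t).mono fun _ h => congrArg Subtype.val h

theorem pastOf_le (hY : IsCTMC G P Y) (s : ℝ≥0) : pastOf Y s ≤ ‹MeasurableSpace Ω› :=
  iSup₂_le fun u _ => (hY.measurable u).comap_le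

/-- `Y` read at the next grid point involves only countably many times, and converges to `Y` by
right-continuity. -/
theorem measurable_uncurry (hY : IsCTMC G P Y) : Measurable fun p : ℝ≥0 × Ω => Y p.1 p.2 := by
  refine measurable_of_tendsto_metrizable (f := fun n (p : ℝ≥0 × Ω) => Y (gridAbove n p.1) p.2)
    (fun n => ?_) (tendsto_pi_nhds.2 fun p => ?_)
  · have h : Measurable fun p : ℕ × Ω => Y (gridPoint n p.1) p.2 :=
      measurable_from_prod_countable_right fun k => hY.measurable (gridPoint n k)
    have h' : Measurable fun p : ℝ≥0 × Ω => (⌊p.1 * (n + 1)⌋₊, p.2) :=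
      (Nat.measurable_floor.comp (measurable_fst.mul_const _)).prodMk measurable_snd
    exact (h.comp h' :)
  · exact tendsto_const_nhds.congr'
      (((tendsto_gridAbove p.1).eventually (hY.isRightLocallyConstant p.2 p.1)).mono
        fun _ h => h.symm)

/-- This is the stopping property of `τ` in its strict form, with respect to the unaugmented past of
`Y`. It suffices because the approximating grid points are strictly later than `τ`. -/
theorem measurableSet_parisianTime_lt (hY : IsCTMC G P Y) (L : ℝ) {D : ℝ} (hD : 0 < D)
    {b s : ℝ≥0} (hbs : b ≤ s) :
    MeasurableSet[pastOf Y s] {ω | parisianTime L D Y ω < b} := by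
  have : {ω | parisianTime L D Y ω < b} = ⋃ i, ⋃ _ : TopologicalSpace.denseSeq ℝ≥0 i < b ∧
        D.toNNReal ≤ TopologicalSpace.denseSeq ℝ≥0 i,
      ({ω | Y (TopologicalSpace.denseSeq ℝ≥0 i) ω ∈ {y : S | (y : ℝ) < L}} ∩
        ⋂ j, ⋂ _ : TopologicalSpace.denseSeq ℝ≥0 j < TopologicalSpace.denseSeq ℝ≥0 i ∧
          TopologicalSpace.denseSeq ℝ≥0 i < TopologicalSpace.denseSeq ℝ≥0 j + D.toNNReal,
          {ω | Y (TopologicalSpace.denseSeq ℝ≥0 j) ω ∈ {y : S | (y : ℝ) < L}}) := by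
    ext ω
    simp only [Set.mem_ofPred_eq, parisianTime, Set.mem_iUnion, Set.mem_inter_iff, Set.mem_iInter,
      parisianTimeBelow_lt_iff_denseSeq hD (hY.isRightLocallyConstant_coe ω), exists_prop,
      and_imp, and_assoc]
  rw [this]
  refine MeasurableSet.iUnion fun i => MeasurableSet.iUnion fun hi =>
    (measurableSet_pastOf (hi.1.le.trans hbs) _).inter ?_
  exact MeasurableSet.iInter fun j => MeasurableSet.iInter fun hj =>
    measurableSet_pastOf ((hj.1.trans hi.1).le.trans hbs) _

theorem measurable_parisianTime (hY : IsCTMC G P Y) (L : ℝ) {D : ℝ} (hD : 0 < D) :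
    Measurable (parisianTime L D Y) := by
  refine measurable_of_Iio fun a => ?_
  have : parisianTime L D Y ⁻¹' Set.Iio a = ⋃ i, ⋃ _ : (TopologicalSpace.denseSeq ℝ≥0 i : ℝ≥0∞) < a,
      {ω | parisianTime L D Y ω < TopologicalSpace.denseSeq ℝ≥0 i} := by
    ext ω
    simp only [Set.mem_preimage, Set.mem_Iio, Set.mem_iUnion, Set.mem_ofPred_eq, exists_prop]
    refine ⟨fun h => ?_, fun ⟨i, h1, h2⟩ => h2.trans h1⟩
    obtain ⟨r, hr1, hr2⟩ := ENNReal.lt_iff_exists_nnreal_btwn.1 h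
    obtain ⟨r', hr1', hr2'⟩ := ENNReal.lt_iff_exists_nnreal_btwn.1 hr2
    obtain ⟨_, ⟨i, rfl⟩, hi⟩ := (TopologicalSpace.denseRange_denseSeq ℝ≥0).exists_between
      (ENNReal.coe_lt_coe.1 hr1')
    exact ⟨i, (ENNReal.coe_lt_coe.2 hi.2).trans hr2', hr1.trans (ENNReal.coe_lt_coe.2 hi.1)⟩
  rw [this]
  exact MeasurableSet.iUnion fun i => MeasurableSet.iUnion fun _ =>
    hY.pastOf_le _ _ (hY.measurableSet_parisianTime_lt L hD le_rfl)

theorem parisianTime_spec (hY : IsCTMC G P Y) (L : ℝ) {D : ℝ} (hD : 0 < D) {ω : Ω}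
    (h : parisianTime L D Y ω ≠ ⊤) : (Y (parisianTime L D Y ω).toNNReal ω : ℝ) < L :=
  lt_at_parisianTimeBelow hD (hY.isRightLocallyConstant_coe ω) h

end IsCTMC

/-! ### The strong Markov property at Parisian times -/

theorem Finset.exists_forall_abs_le {S : Finset ℝ} (f : S → ℝ) :
    ∃ C, 0 ≤ C ∧ ∀ y, |f y| ≤ C :=
  ⟨∑ y, |f y|, Finset.sum_nonneg fun _ _ => abs_nonneg _,
    fun y => Finset.single_le_sum (f := fun y => |f y|) (fun _ _ => abs_nonneg _)
      (Finset.mem_univ y)⟩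

theorem Complex.norm_exp_neg_mul_ofReal (q : ℂ) (t : ℝ) :
    ‖Complex.exp (-q * (t : ℂ))‖ = Real.exp (-q.re * t) := by
  rw [Complex.norm_exp]; simp

theorem Complex.norm_exp_neg_mul_ofReal_le_one {q : ℂ} (hq : 0 < q.re) {t : ℝ} (ht : 0 ≤ t) :
    ‖Complex.exp (-q * (t : ℂ))‖ ≤ 1 := by
  rw [Complex.norm_exp_neg_mul_ofReal, Real.exp_le_one_iff]
  nlinarith

namespace IsCTMC

variable {S : Finset ℝ} {Ω : Type*} [MeasurableSpace Ω] {G : Matrix S S ℝ} {P : S → Measure Ω}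
  {Y : ℝ≥0 → Ω → S}

theorem integrable_comp (hY : IsCTMC G P Y) (f : S → ℝ) (x : S) (t : ℝ≥0) :
    Integrable (fun ω => f (Y t ω)) (P x) := by
  have := hY.isProbabilityMeasure x
  obtain ⟨C, -, hC⟩ := Finset.exists_forall_abs_le f
  exact Integrable.of_bound ((measurable_of_finite f).comp (hY.measurable t)).aestronglyMeasurable C
    (Eventually.of_forall fun ω => hC _)

theorem measurable_exp_parisianTime (hY : IsCTMC G P Y) (L : ℝ) {D : ℝ} (hD : 0 < D) (q : ℂ) :
    Measurable fun ω => Complex.exp (-q * ((parisianTime L D Y ω).toReal : ℂ)) := by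
  have := (hY.measurable_parisianTime L hD).ennreal_toReal
  fun_prop

theorem abs_europeanPrice_le (hY : IsCTMC G P Y) {f : S → ℝ} {C : ℝ} (hC : ∀ y, |f y| ≤ C)
    (t : ℝ≥0) (x : S) : |europeanPrice P Y f t x| ≤ C := by
  have := hY.isProbabilityMeasure x
  simpa [europeanPrice] using norm_integral_le_of_norm_le_const (μ := P x)
    (f := fun ω => f (Y t ω)) (C := C) (Eventually.of_forall fun ω => hC _)

theorem measurableSet_eq (hY : IsCTMC G P Y) (t : ℝ≥0) (z : S) :
    MeasurableSet {ω | Y t ω = z} :=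
  hY.measurable t (measurableSet_singleton z)

theorem integral_comp_eq_sum (hY : IsCTMC G P Y) (μ : Measure Ω) [IsFiniteMeasure μ] (g : S → ℝ)
    (t : ℝ≥0) : ∫ ω, g (Y t ω) ∂μ = ∑ z, μ.real {ω | Y t ω = z} * g z := by
  have h : (fun ω => g (Y t ω)) =
      fun ω => ∑ z, {ω | Y t ω = z}.indicator (fun _ => g z) ω := by
    ext ω
    simp [Set.indicator_apply]
  rw [h, integral_finsetSum _ fun z _ =>
    (integrable_const _).indicator (hY.measurableSet_eq t z)]
  refine Finset.sum_congr rfl fun z _ => ?_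
  rw [integral_indicator_const _ (hY.measurableSet_eq t z), smul_eq_mul]

/-- The Markov property for functions of the state. -/
theorem setIntegral_comp_add (hY : IsCTMC G P Y) (f : S → ℝ) (x : S) (r s : ℝ≥0) {A : Set Ω}
    (hA : MeasurableSet[pastOf Y r] A) :
    ∫ ω in A, f (Y (r + s) ω) ∂(P x) = ∫ ω in A, europeanPrice P Y f s (Y r ω) ∂(P x) := by
  have hPr := hY.isProbabilityMeasure
  have hA' : MeasurableSet A := hY.pastOf_le r _ hA
  have hm := hY.measurableSet_eq
  rw [hY.integral_comp_eq_sum, hY.integral_comp_eq_sum]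
  simp only [europeanPrice, hY.integral_comp_eq_sum, Finset.mul_sum]
  rw [Finset.sum_comm]
  refine Finset.sum_congr rfl fun z _ => ?_
  simp only [← mul_assoc, ← Finset.sum_mul]
  congr 1
  simp only [measureReal_restrict_apply (hm _ _)]
  have h2 : (P x).real ({ω | Y (r + s) ω = z} ∩ A) =
      ∑ y, (P x).real (A ∩ {ω | Y r ω = y} ∩ {ω | Y (r + s) ω = z}) := by
    rw [← measureReal_biUnion_finset]
    · congr 1
      ext ω
      simp [and_comm]
    · intro y _ y' _ hne
      refine Set.disjoint_left.2 fun ω h h' => hne ?_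
      exact h.1.2.symm.trans h'.1.2
    · exact fun y _ => (hA'.inter (hm _ _)).inter (hm _ _)
  rw [h2]
  refine Finset.sum_congr rfl fun y _ => ?_
  rw [hY.markov x r s A hA y z, Set.inter_comm A]

/-- The strong Markov property at the grid approximations of the Parisian time. -/
theorem setIntegral_gridAbove_parisianTime (hY : IsCTMC G P Y) (L : ℝ) {D : ℝ} (hD : 0 < D)
    (f : S → ℝ) {q : ℂ} (hq : 0 < q.re) (x : S) (s : ℝ≥0) (n : ℕ) :
    ∫ ω in {ω | parisianTime L D Y ω ≠ ⊤},
      Complex.exp (-q * ((gridAbove n (parisianTime L D Y ω).toNNReal : ℝ) : ℂ)) *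
        ((f (Y (gridAbove n (parisianTime L D Y ω).toNNReal + s) ω) -
          europeanPrice P Y f s (Y (gridAbove n (parisianTime L D Y ω).toNNReal) ω) : ℝ) : ℂ)
        ∂(P x) = 0 := by
  have hPr := hY.isProbabilityMeasure
  have hτ := hY.measurable_parisianTime L hD
  -- `A k` is the event that `τ` lies in `[k/(n+1), (k+1)/(n+1))`. It is known at the right
  -- endpoint, which is the value of `gridAbove` there.
  set A : ℕ → Set Ω := fun k =>
    {ω | parisianTime L D Y ω < ((k / (n + 1) : ℝ≥0) : ℝ≥0∞)}ᶜ ∩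
      {ω | parisianTime L D Y ω < (gridPoint n k : ℝ≥0∞)} with hAdef
  have hkg : ∀ k : ℕ, (k / (n + 1) : ℝ≥0) ≤ gridPoint n k := fun k => by
    unfold gridPoint; gcongr; simp
  have hA : ∀ k, MeasurableSet[pastOf Y (gridPoint n k)] (A k) := fun k =>
    (hY.measurableSet_parisianTime_lt L hD (hkg k)).compl.inter
      (hY.measurableSet_parisianTime_lt L hD le_rfl)
  have hA' : ∀ k, MeasurableSet (A k) := fun k => hY.pastOf_le _ _ (hA k)
  have hmem : ∀ ω k, ω ∈ A k ↔ parisianTime L D Y ω ≠ ⊤ ∧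
      ⌊(parisianTime L D Y ω).toNNReal * (n + 1)⌋₊ = k := fun ω k => by
    rw [floor_mul_eq_iff]
    constructor
    · rintro ⟨h1, h2⟩
      have hne : parisianTime L D Y ω ≠ ⊤ := (lt_top_of_lt h2).ne
      refine ⟨hne, ?_⟩
      rw [← ENNReal.coe_lt_coe, ← ENNReal.coe_lt_coe, ENNReal.coe_toNNReal hne]
      exact ⟨h1, h2⟩
    · rintro ⟨hne, h⟩
      rw [← ENNReal.coe_lt_coe, ← ENNReal.coe_lt_coe, ENNReal.coe_toNNReal hne] at h
      exact h
  have hU : {ω | parisianTime L D Y ω ≠ ⊤} = ⋃ k, A k := by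
    ext ω
    simp [hmem]
  have hdisj : Pairwise (Function.onFun Disjoint A) := fun k l hkl =>
    Set.disjoint_left.2 fun ω h h' => hkl (((hmem ω k).1 h).2.symm.trans ((hmem ω l).1 h').2)
  obtain ⟨C, hC0, hC⟩ := Finset.exists_forall_abs_le f
  have hgm : Measurable fun ω => gridAbove n (parisianTime L D Y ω).toNNReal :=
    (measurable_from_nat (f := gridPoint n)).comp
      (Nat.measurable_floor.comp (hτ.ennreal_toNNReal.mul_const _))
  have hYm : ∀ c : ℝ≥0, Measurable fun ω =>
      Y (gridAbove n (parisianTime L D Y ω).toNNReal + c) ω := fun c =>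
    (hY.measurable_uncurry.comp ((hgm.add_const c).prodMk measurable_id) :)
  have hint : Integrable (fun ω =>
      Complex.exp (-q * ((gridAbove n (parisianTime L D Y ω).toNNReal : ℝ) : ℂ)) *
        ((f (Y (gridAbove n (parisianTime L D Y ω).toNNReal + s) ω) -
          europeanPrice P Y f s (Y (gridAbove n (parisianTime L D Y ω).toNNReal) ω) : ℝ) : ℂ))
      (P x) := by
    refine Integrable.of_bound (Measurable.aestronglyMeasurable ?_) (C + C)
      (Eventually.of_forall fun ω => ?_)
    · have h1 := (measurable_of_finite f).comp (hYm s)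
      have h2 := (measurable_of_finite (europeanPrice P Y f s)).comp (hYm 0)
      simp only [add_zero] at h2
      have h3 := hgm.coe_nnreal_real
      exact (Complex.measurable_exp.comp ((Complex.measurable_ofReal.comp h3).const_mul _)).mul
        (Complex.measurable_ofReal.comp (h1.sub h2))
    · rw [norm_mul, ← one_mul (C + C), Complex.norm_real]
      gcongr
      · exact Complex.norm_exp_neg_mul_ofReal_le_one hq (NNReal.coe_nonneg _)
      · exact (norm_sub_le _ _).trans (add_le_add (hC _) (hY.abs_europeanPrice_le hC _ _))
  rw [hU, integral_iUnion hA' hdisj hint.integrableOn]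
  refine (tsum_congr fun k => ?_).trans tsum_zero
  have hcongr : ∀ ω ∈ A k,
      Complex.exp (-q * ((gridAbove n (parisianTime L D Y ω).toNNReal : ℝ) : ℂ)) *
        ((f (Y (gridAbove n (parisianTime L D Y ω).toNNReal + s) ω) -
          europeanPrice P Y f s (Y (gridAbove n (parisianTime L D Y ω).toNNReal) ω) : ℝ) : ℂ) =
      Complex.exp (-q * ((gridPoint n k : ℝ) : ℂ)) *
        ((f (Y (gridPoint n k + s) ω) - europeanPrice P Y f s (Y (gridPoint n k) ω) : ℝ) : ℂ) := by
    intro ω hω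
    have : gridAbove n (parisianTime L D Y ω).toNNReal = gridPoint n k := by
      rw [gridAbove, ((hmem ω k).1 hω).2]
    rw [this]
  -- On each cell the time is deterministic, so the simple Markov property makes the two integrals
  -- cancel.
  rw [setIntegral_congr_fun (hA' k) hcongr, integral_const_mul, integral_complex_ofReal,
    integral_sub (hY.integrable_comp f x _).integrableOn
      (hY.integrable_comp (europeanPrice P Y f s) x _).integrableOn,
    hY.setIntegral_comp_add f x _ s (hA k)]
  simp

theorem measurable_comp_parisianTime (hY : IsCTMC G P Y) (L : ℝ) {D : ℝ} (hD : 0 < D) (c : ℝ≥0) :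
    Measurable fun ω => Y ((parisianTime L D Y ω).toNNReal + c) ω :=
  (hY.measurable_uncurry.comp
    (((hY.measurable_parisianTime L hD).ennreal_toNNReal.add_const c).prodMk measurable_id) :)

/-- The strong Markov property at the Parisian time. -/
theorem setIntegral_parisianTime (hY : IsCTMC G P Y) (L : ℝ) {D : ℝ} (hD : 0 < D)
    (f : S → ℝ) {q : ℂ} (hq : 0 < q.re) (x : S) (s : ℝ≥0) :
    ∫ ω in {ω | parisianTime L D Y ω ≠ ⊤},
      Complex.exp (-q * ((parisianTime L D Y ω).toReal : ℂ)) *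
        ((f (Y ((parisianTime L D Y ω).toNNReal + s) ω) -
          europeanPrice P Y f s (Y (parisianTime L D Y ω).toNNReal ω) : ℝ) : ℂ)
        ∂(P x) = 0 := by
  have hPr := hY.isProbabilityMeasure
  have hτ := hY.measurable_parisianTime L hD
  obtain ⟨C, hC0, hC⟩ := Finset.exists_forall_abs_le f
  -- The grid integrals are all `0` and converge to the integral at `τ`; `C + C` bounds `f` and the
  -- European price together.
  refine tendsto_nhds_unique (tendsto_integral_of_dominated_convergence (fun _ => C + C)
    (fun n => ?_) (integrable_const _) (fun n => Eventually.of_forall fun ω => ?_)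
    (Eventually.of_forall fun ω => ?_))
    (tendsto_const_nhds.congr fun n =>
      (hY.setIntegral_gridAbove_parisianTime L hD f hq x s n).symm)
  · have hgm : Measurable fun ω => gridAbove n (parisianTime L D Y ω).toNNReal :=
      (measurable_from_nat (f := gridPoint n)).comp
        (Nat.measurable_floor.comp (hτ.ennreal_toNNReal.mul_const _))
    have hYm : ∀ c : ℝ≥0, Measurable fun ω =>
        Y (gridAbove n (parisianTime L D Y ω).toNNReal + c) ω := fun c =>
      (hY.measurable_uncurry.comp ((hgm.add_const c).prodMk measurable_id) :)
    have h1 := (measurable_of_finite f).comp (hYm s)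
    have h2 := (measurable_of_finite (europeanPrice P Y f s)).comp (hYm 0)
    simp only [add_zero] at h2
    have h3 := hgm.coe_nnreal_real
    exact ((Complex.measurable_exp.comp ((Complex.measurable_ofReal.comp h3).const_mul _)).mul
      (Complex.measurable_ofReal.comp (h1.sub h2))).aestronglyMeasurable
  · rw [norm_mul, ← one_mul (C + C), Complex.norm_real]
    gcongr
    · exact Complex.norm_exp_neg_mul_ofReal_le_one hq (NNReal.coe_nonneg _)
    · exact (norm_sub_le _ _).trans (add_le_add (hC _) (hY.abs_europeanPrice_le hC _ _))
  · set T := (parisianTime L D Y ω).toNNReal with hT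
    have hTr : (parisianTime L D Y ω).toReal = (T : ℝ) := rfl
    rw [hTr]
    have hg := tendsto_gridAbove T
    have hgs : Tendsto (fun n => gridAbove n T + s) atTop (𝓝[≥] (T + s)) := by
      refine tendsto_nhdsWithin_iff.2 ⟨(tendsto_nhds_of_tendsto_nhdsWithin hg).add_const s,
        Eventually.of_forall fun n => ?_⟩
      exact add_le_add_left (lt_gridAbove n T).le s
    have e1 := hg.eventually (hY.isRightLocallyConstant ω T)
    have e2 := hgs.eventually (hY.isRightLocallyConstant ω (T + s))
    have h3 : Tendsto (fun n => Complex.exp (-q * ((gridAbove n T : ℝ) : ℂ))) atTop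
        (𝓝 (Complex.exp (-q * ((T : ℝ) : ℂ)))) := by
      have hc : Continuous fun t : ℝ≥0 => Complex.exp (-q * ((t : ℝ) : ℂ)) := by fun_prop
      exact (hc.tendsto T).comp (tendsto_nhds_of_tendsto_nhdsWithin hg)
    -- Only the exponential has a genuine limit: both states are eventually constant in `n`, as the
    -- grid times approach `T` and `T + s` from the right.
    refine (h3.mul_const _).congr' ?_
    filter_upwards [e1, e2] with n h1 h2
    rw [h1, h2]

end IsCTMC

/-! ### Laplace transforms -/

/-- Justifies the interchanges of time integral and expectation. -/
theorem integrable_exp_neg_mul_of_bound {Ω : Type*} [MeasurableSpace Ω] {μ : Measure Ω}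
    [IsFiniteMeasure μ] {q : ℂ} (hq : 0 < q.re) {F : ℝ → Ω → ℂ}
    (hF : Measurable (Function.uncurry F)) {C : ℝ} (hC : ∀ t ω, ‖F t ω‖ ≤ C) :
    Integrable (Function.uncurry fun (t : ℝ) ω => Complex.exp (-q * (t : ℂ)) * F t ω)
      ((volume.restrict (Set.Ioi 0)).prod μ) := by
  have h := (exp_neg_integrableOn_Ioi 0 hq).integrable.mul_prod
    (integrable_const (μ := μ) C)
  refine h.mono' (Measurable.aestronglyMeasurable ?_) (Eventually.of_forall fun p => ?_)
  · have : Measurable fun p : ℝ × Ω => Complex.exp (-q * (p.1 : ℂ)) := by fun_prop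
    exact this.mul hF
  · rw [Function.uncurry, norm_mul, Complex.norm_exp_neg_mul_ofReal]
    exact mul_le_mul_of_nonneg_left (hC _ _) (Real.exp_nonneg _)

theorem integrableOn_laplaceIntegrand {u : ℝ≥0 → ℝ} (hu : Measurable u) {C : ℝ}
    (hC : ∀ t, |u t| ≤ C) {q : ℂ} (hq : 0 < q.re) :
    IntegrableOn (laplaceIntegrand u q) (Set.Ioi 0) := by
  refine ((exp_neg_integrableOn_Ioi 0 hq).mul_const C).mono'
    (Measurable.aestronglyMeasurable ?_) (Eventually.of_forall fun t => ?_)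
  · have h1 : Measurable fun t : ℝ => Complex.exp (-q * (t : ℂ)) := by fun_prop
    exact h1.mul (Complex.measurable_ofReal.comp (hu.comp measurable_real_toNNReal))
  · rw [laplaceIntegrand, norm_mul, Complex.norm_exp_neg_mul_ofReal, Complex.norm_real]
    exact mul_le_mul_of_nonneg_left (hC _) (Real.exp_nonneg _)

/-- Translation of a Laplace integral. -/
theorem setIntegral_Ioi_laplaceIntegrand (u : ℝ≥0 → ℝ) (q : ℂ) (T : ℝ≥0) :
    ∫ t in Set.Ioi (T : ℝ), laplaceIntegrand u q t =
      Complex.exp (-q * ((T : ℝ) : ℂ)) * laplaceTransform (fun t => u (T + t)) q := by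
  have h := (measurePreserving_add_right volume (T : ℝ)).setIntegral_preimage_emb
    (measurableEmbedding_addRight (T : ℝ)) (laplaceIntegrand u q) (Set.Ioi (T : ℝ))
  rw [← h, laplaceTransform, ← integral_const_mul]
  have hs : (fun x : ℝ => x + T) ⁻¹' Set.Ioi (T : ℝ) = Set.Ioi 0 := by
    ext x; simp
  rw [hs]
  refine setIntegral_congr_fun measurableSet_Ioi fun t ht => ?_
  have ht' : (t + T).toNNReal = T + t.toNNReal := by
    rw [Real.toNNReal_add (le_of_lt ht) T.coe_nonneg, add_comm, Real.toNNReal_coe]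
  simp only [laplaceIntegrand, ht']
  rw [← mul_assoc, ← Complex.exp_add]
  push_cast
  ring_nf

namespace IsCTMC

variable {S : Finset ℝ} {Ω : Type*} [MeasurableSpace Ω] {G : Matrix S S ℝ} {P : S → Measure Ω}
  {Y : ℝ≥0 → Ω → S}

theorem measurable_europeanPrice (hY : IsCTMC G P Y) (f : S → ℝ) (z : S) :
    Measurable fun t => europeanPrice P Y f t z := by
  have := hY.isProbabilityMeasure z
  have h : StronglyMeasurable (Function.uncurry fun (t : ℝ≥0) ω => f (Y t ω)) :=
    ((measurable_of_finite f).comp hY.measurable_uncurry).stronglyMeasurable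
  exact h.integral_prod_right.measurable

theorem integrableOn_laplace_europeanPrice (hY : IsCTMC G P Y) (f : S → ℝ) {q : ℂ}
    (hq : 0 < q.re) (z : S) :
    IntegrableOn (laplaceIntegrand (fun t => europeanPrice P Y f t z) q) (Set.Ioi 0) := by
  obtain ⟨C, -, hC⟩ := Finset.exists_forall_abs_le f
  exact integrableOn_laplaceIntegrand (hY.measurable_europeanPrice f z)
    (fun t => hY.abs_europeanPrice_le hC t z) hq

/-! ### The down-and-in payoff and its Laplace transform. -/

theorem measurable_uncurry_downInPayoff (hY : IsCTMC G P Y) (L : ℝ) {D : ℝ} (hD : 0 < D)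
    (f : S → ℝ) : Measurable (Function.uncurry (downInPayoff L D Y f)) := by
  have h1 := (measurable_of_finite f).comp hY.measurable_uncurry
  refine Measurable.ite (measurableSet_le ?_ ?_) h1 measurable_const
  · exact (hY.measurable_parisianTime L hD).comp measurable_snd
  · exact measurable_fst.coe_nnreal_ennreal

omit [MeasurableSpace Ω] in
theorem abs_downInPayoff_le {f : S → ℝ} {C : ℝ} (hC0 : 0 ≤ C) (hC : ∀ y, |f y| ≤ C) (L D : ℝ)
    (t : ℝ≥0) (ω : Ω) : |downInPayoff L D Y f t ω| ≤ C := by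
  unfold downInPayoff
  split_ifs
  · exact hC _
  · simpa using hC0

theorem integrable_downInPayoff (hY : IsCTMC G P Y) (L : ℝ) {D : ℝ} (hD : 0 < D) (f : S → ℝ)
    (x : S) (t : ℝ≥0) : Integrable (downInPayoff L D Y f t) (P x) := by
  have := hY.isProbabilityMeasure x
  obtain ⟨C, hC0, hC⟩ := Finset.exists_forall_abs_le f
  exact Integrable.of_bound
    ((hY.measurable_uncurry_downInPayoff L hD f).of_uncurry_left).aestronglyMeasurable C
    (Eventually.of_forall fun ω => abs_downInPayoff_le hC0 hC L D t ω)

theorem integrableOn_laplace_downInPrice (hY : IsCTMC G P Y) (L : ℝ) {D : ℝ} (hD : 0 < D)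
    (f : S → ℝ) {q : ℂ} (hq : 0 < q.re) (x : S) :
    IntegrableOn (laplaceIntegrand (fun t => downInPrice P Y L D f t x) q) (Set.Ioi 0) := by
  have := hY.isProbabilityMeasure x
  obtain ⟨C, hC0, hC⟩ := Finset.exists_forall_abs_le f
  refine integrableOn_laplaceIntegrand (C := C) ?_ (fun t => ?_) hq
  · exact (hY.measurable_uncurry_downInPayoff L hD f).stronglyMeasurable.integral_prod_right.measurable
  · simpa [downInPrice] using norm_integral_le_of_norm_le_const (μ := P x)
      (f := downInPayoff L D Y f t) (C := C)
      (Eventually.of_forall fun ω => abs_downInPayoff_le hC0 hC L D t ω)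

omit [MeasurableSpace Ω] in
theorem discountedHit_eq_indicator (L D : ℝ) (Y : ℝ≥0 → Ω → S) (q : ℂ) (z : S) :
    discountedHit L D Y q z = {ω | parisianTime L D Y ω ≠ ⊤}.indicator fun ω =>
      if Y (parisianTime L D Y ω).toNNReal ω = z then
        Complex.exp (-q * ((parisianTime L D Y ω).toReal : ℂ)) else 0 := by
  ext ω
  simp only [discountedHit, Set.indicator_apply, Set.mem_ofPred_eq, ite_and]

theorem measurableSet_parisianTime_ne_top (hY : IsCTMC G P Y) (L : ℝ) {D : ℝ} (hD : 0 < D) :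
    MeasurableSet {ω | parisianTime L D Y ω ≠ ⊤} :=
  (hY.measurable_parisianTime L hD (measurableSet_singleton ⊤)).compl

theorem integrable_discountedHit (hY : IsCTMC G P Y) (L : ℝ) {D : ℝ} (hD : 0 < D) {q : ℂ}
    (hq : 0 < q.re) (x z : S) : Integrable (discountedHit L D Y q z) (P x) := by
  have := hY.isProbabilityMeasure x
  refine Integrable.of_bound (Measurable.aestronglyMeasurable ?_) 1
    (Eventually.of_forall fun ω => ?_)
  · rw [discountedHit_eq_indicator]
    refine Measurable.indicator ?_ (hY.measurableSet_parisianTime_ne_top L hD)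
    have h := hY.measurable_comp_parisianTime L hD 0
    simp only [add_zero] at h
    exact Measurable.ite (h (measurableSet_singleton z)) (hY.measurable_exp_parisianTime L hD q)
      measurable_const
  · unfold discountedHit
    split_ifs
    · exact Complex.norm_exp_neg_mul_ofReal_le_one hq ENNReal.toReal_nonneg
    · simp

/-- Expectations of functions of the state at the Parisian time through the transforms
`parisianTransform`. -/
theorem setIntegral_exp_mul_comp_parisianTime (hY : IsCTMC G P Y) (L : ℝ) {D : ℝ} (hD : 0 < D)
    (g : S → ℝ) {q : ℂ} (hq : 0 < q.re) (x : S) :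
    ∫ ω in {ω | parisianTime L D Y ω ≠ ⊤},
      Complex.exp (-q * ((parisianTime L D Y ω).toReal : ℂ)) *
        (g (Y (parisianTime L D Y ω).toNNReal ω) : ℂ) ∂(P x) =
      ∑ z, parisianTransform P Y L D q x z * (g z : ℂ) := by
  rw [← integral_indicator (hY.measurableSet_parisianTime_ne_top L hD)]
  simp only [parisianTransform, ← integral_mul_const]
  rw [← integral_finsetSum _ fun z _ => (hY.integrable_discountedHit L hD hq x z).mul_const _]
  congr 1
  ext ω
  by_cases h : parisianTime L D Y ω = ⊤ <;> simp [discountedHit, h]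

theorem parisianTransform_eq_zero (hY : IsCTMC G P Y) {L D : ℝ} (hD : 0 < D) (q : ℂ) (x : S)
    {z : S} (hz : ¬ (z : ℝ) < L) : parisianTransform P Y L D q x z = 0 := by
  have h : discountedHit L D Y q z = fun _ => 0 := by
    ext ω
    refine if_neg fun ⟨h1, h2⟩ => hz ?_
    rw [← h2]
    exact hY.parisianTime_spec L hD h1
  rw [parisianTransform, h, integral_zero]

omit [MeasurableSpace Ω] in
/-- The time integral of the discounted down-and-in payoff along a path. -/
theorem laplaceTransform_downInPayoff (L D : ℝ) (Y : ℝ≥0 → Ω → S) (f : S → ℝ) (q : ℂ) (ω : Ω) :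
    laplaceTransform (fun t => downInPayoff L D Y f t ω) q =
      {ω | parisianTime L D Y ω ≠ ⊤}.indicator (fun ω =>
        Complex.exp (-q * ((parisianTime L D Y ω).toReal : ℂ)) *
          laplaceTransform (fun s => f (Y ((parisianTime L D Y ω).toNNReal + s) ω)) q) ω := by
  by_cases h : parisianTime L D Y ω = ⊤
  · simp [h, downInPayoff, laplaceTransform, laplaceIntegrand]
  rw [Set.indicator_of_mem (by exact h)]
  set T := (parisianTime L D Y ω).toNNReal with hT
  have hTτ : parisianTime L D Y ω = (T : ℝ≥0∞) := (ENNReal.coe_toNNReal h).symm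
  have hTr : (parisianTime L D Y ω).toReal = (T : ℝ) := rfl
  rw [hTr, ← setIntegral_Ioi_laplaceIntegrand (fun t => f (Y t ω)), laplaceTransform,
    setIntegral_eq_of_subset_of_ae_sdiff_eq_zero (s := Set.Ioi (T : ℝ))
      measurableSet_Ioi.nullMeasurableSet (Set.Ioi_subset_Ioi T.2)]
  · refine setIntegral_congr_fun measurableSet_Ioi fun t ht => ?_
    have : T ≤ t.toNNReal := NNReal.le_toNNReal_of_coe_le (le_of_lt ht)
    simp [laplaceIntegrand, downInPayoff, hTτ, this]
  -- The point `t = T` has to be discarded: the option is already knocked in there, so the payoff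
  -- need not vanish.
  · filter_upwards [compl_mem_ae_iff.2 (measure_singleton (T : ℝ))] with t ht hmem
    have hlt : t < T := lt_of_le_of_ne (not_lt.1 hmem.2) ht
    have : ¬ T ≤ t.toNNReal := by
      rw [not_le, Real.toNNReal_lt_iff_lt_coe (le_of_lt hmem.1)]
      exact hlt
    simp [laplaceIntegrand, downInPayoff, hTτ, this]

theorem laplaceTransform_downInPrice (hY : IsCTMC G P Y) (L : ℝ) {D : ℝ} (hD : 0 < D)
    (f : S → ℝ) {q : ℂ} (hq : 0 < q.re) (x : S) :
    laplaceTransform (fun t => downInPrice P Y L D f t x) q =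
      ∑ z, parisianTransform P Y L D q x z *
        laplaceTransform (fun t => europeanPrice P Y f t z) q := by
  have := hY.isProbabilityMeasure x
  obtain ⟨C, hC0, hC⟩ := Finset.exists_forall_abs_le f
  have hB := hY.measurableSet_parisianTime_ne_top L hD
  have hτ := hY.measurable_parisianTime L hD
  have h1 : laplaceTransform (fun t => downInPrice P Y L D f t x) q =
      ∫ ω, laplaceTransform (fun t => downInPayoff L D Y f t ω) q ∂(P x) := by
    simp only [laplaceTransform, laplaceIntegrand, downInPrice]
    rw [← integral_integral_swap (integrable_exp_neg_mul_of_bound (C := C) hq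
      (F := fun t ω => (downInPayoff L D Y f t.toNNReal ω : ℂ)) ?_ fun t ω => ?_)]
    · simp only [integral_const_mul, integral_complex_ofReal]
    · exact Complex.measurable_ofReal.comp ((hY.measurable_uncurry_downInPayoff L hD f).comp
        ((measurable_real_toNNReal.comp measurable_fst).prodMk measurable_snd))
    · rw [Complex.norm_real]
      exact abs_downInPayoff_le hC0 hC L D _ ω
  -- For a fixed delay `s` after `τ`, the strong Markov property followed by a decomposition over
  -- the state at `τ`.
  have h2 : ∀ s : ℝ≥0, ∫ ω in {ω | parisianTime L D Y ω ≠ ⊤},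
      Complex.exp (-q * ((parisianTime L D Y ω).toReal : ℂ)) *
        (f (Y ((parisianTime L D Y ω).toNNReal + s) ω) : ℂ) ∂(P x) =
      ∑ z, parisianTransform P Y L D q x z * (europeanPrice P Y f s z : ℂ) := fun s => by
    have hi : ∀ (c : ℝ≥0) (g : S → ℝ), Integrable (fun ω =>
        Complex.exp (-q * ((parisianTime L D Y ω).toReal : ℂ)) *
        (g (Y ((parisianTime L D Y ω).toNNReal + c) ω) : ℂ)) (P x) := fun c g => by
      obtain ⟨K, hK0, hK⟩ := Finset.exists_forall_abs_le g
      refine Integrable.of_bound (C := 1 * K) (Measurable.aestronglyMeasurable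
        ((hY.measurable_exp_parisianTime L hD q).mul (Complex.measurable_ofReal.comp
          ((measurable_of_finite g).comp (hY.measurable_comp_parisianTime L hD c)))))
        (Eventually.of_forall fun ω => ?_)
      rw [norm_mul, Complex.norm_real]
      gcongr
      · exact Complex.norm_exp_neg_mul_ofReal_le_one hq ENNReal.toReal_nonneg
      · exact hK _
    have h := hY.setIntegral_parisianTime L hD f hq x s
    have hi2 := hi 0 (europeanPrice P Y f s)
    simp only [add_zero] at hi2
    simp only [Complex.ofReal_sub, mul_sub] at h
    rw [integral_sub (hi s f).integrableOn hi2.integrableOn, sub_eq_zero] at h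
    rw [h, hY.setIntegral_exp_mul_comp_parisianTime L hD (europeanPrice P Y f s) hq x]
  rw [h1]
  simp only [laplaceTransform_downInPayoff]
  rw [integral_indicator hB]
  -- A second use of Fubini brings the delay `s` outside, so that `h2` applies for each `s`.
  have h3 : ∫ ω in {ω | parisianTime L D Y ω ≠ ⊤},
        Complex.exp (-q * ((parisianTime L D Y ω).toReal : ℂ)) *
          laplaceTransform (fun s => f (Y ((parisianTime L D Y ω).toNNReal + s) ω)) q ∂(P x) =
      ∫ s in Set.Ioi (0 : ℝ), ∫ ω in {ω | parisianTime L D Y ω ≠ ⊤},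
        Complex.exp (-q * (s : ℂ)) *
        (Complex.exp (-q * ((parisianTime L D Y ω).toReal : ℂ)) *
          (f (Y ((parisianTime L D Y ω).toNNReal + s.toNNReal) ω) : ℂ)) ∂(P x) := by
    rw [integral_integral_swap (integrable_exp_neg_mul_of_bound (C := 1 * C) hq
      (F := fun s ω => Complex.exp (-q * ((parisianTime L D Y ω).toReal : ℂ)) *
          (f (Y ((parisianTime L D Y ω).toNNReal + s.toNNReal) ω) : ℂ)) ?_ fun t ω => ?_)]
    · congr 1
      ext ω
      simp only [laplaceTransform, laplaceIntegrand]
      rw [← integral_const_mul]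
      congr 1
      ext s
      ring
    · have hp := (hY.measurable_uncurry.comp
        (((hτ.ennreal_toNNReal.comp measurable_snd).add
          (measurable_real_toNNReal.comp measurable_fst)).prodMk
            (measurable_snd (α := ℝ) (β := Ω))))
      exact ((hY.measurable_exp_parisianTime L hD q).comp measurable_snd).mul
        (Complex.measurable_ofReal.comp ((measurable_of_finite f).comp hp))
    · rw [norm_mul, Complex.norm_real]
      gcongr
      · exact Complex.norm_exp_neg_mul_ofReal_le_one hq ENNReal.toReal_nonneg
      · exact hC _
  rw [h3]
  simp only [integral_const_mul, h2, Finset.mul_sum]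
  rw [integral_finsetSum]
  · refine Finset.sum_congr rfl fun z _ => ?_
    rw [laplaceTransform, ← integral_const_mul]
    congr 1
    ext s
    simp only [laplaceIntegrand]
    ring
  · intro z _
    refine ((hY.integrableOn_laplace_europeanPrice f hq z).integrable.const_mul
      (parisianTransform P Y L D q x z)).congr (Eventually.of_forall fun s => ?_)
    simp only [laplaceIntegrand]
    ring

/-! ### The resolvent equation -/

/-- Chapman-Kolmogorov, from the Markov property with the trivial event. -/
theorem europeanPrice_add (hY : IsCTMC G P Y) (f : S → ℝ) (h t : ℝ≥0) (z : S) :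
    europeanPrice P Y f (h + t) z =
      ∑ y, (P z).real {ω | Y h ω = y} * europeanPrice P Y f t y := by
  have := hY.isProbabilityMeasure z
  have h1 := hY.setIntegral_comp_add f z h t (A := Set.univ) MeasurableSet.univ
  rw [Measure.restrict_univ] at h1
  rw [europeanPrice, h1, hY.integral_comp_eq_sum]

theorem tendsto_europeanPrice_zero (hY : IsCTMC G P Y) (f : S → ℝ) (z : S) :
    Tendsto (fun t => europeanPrice P Y f t z) (𝓝 0) (𝓝 (f z)) := by
  have := hY.isProbabilityMeasure z
  obtain ⟨C, -, hC⟩ := Finset.exists_forall_abs_le f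
  have h0 : ∫ ω, f (Y 0 ω) ∂(P z) = f z := by
    rw [integral_congr_ae ((hY.start z).mono fun ω h => congrArg f h)]
    simp
  rw [← h0]
  refine tendsto_integral_filter_of_dominated_convergence (fun _ => C)
    (Eventually.of_forall fun t => (hY.integrable_comp f z t).aestronglyMeasurable)
    (Eventually.of_forall fun t => Eventually.of_forall fun ω => hC _) (integrable_const _)
    (Eventually.of_forall fun ω => ?_)
  refine tendsto_const_nhds.congr' ?_
  have h := hY.isRightLocallyConstant ω 0
  -- Since `0` is the least element of `ℝ≥0`, right-continuity there is continuity.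
  rw [show Set.Ici (0 : ℝ≥0) = Set.univ from Set.eq_univ_of_forall fun t => bot_le (a := t),
    nhdsWithin_univ] at h
  exact h.mono fun t ht => congrArg f ht.symm

/-- Only the transition probabilities are differentiated, at time `0`; the European price need not
be differentiable in time, only continuous at `0`. -/
theorem laplaceTransform_europeanPrice_linear_system (hY : IsCTMC G P Y) (f : S → ℝ) {q : ℂ}
    (hq : 0 < q.re) (z : S) :
    q * laplaceTransform (fun t => europeanPrice P Y f t z) q -
      ∑ y : S, (G z y : ℂ) * laplaceTransform (fun t => europeanPrice P Y f t y) q = (f z : ℂ) := by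
  classical
  set w : S → ℂ := fun y => laplaceTransform (fun t => europeanPrice P Y f t y) q with hw
  set u := laplaceIntegrand (fun t => europeanPrice P Y f t z) q with hu
  have hint : ∀ a : ℝ≥0, IntegrableOn u (Set.Ioi (a : ℝ)) := fun a =>
    (hY.integrableOn_laplace_europeanPrice f hq z).mono_set (Set.Ioi_subset_Ioi a.2)
  -- Averaging `w` over `Y_h` gives the transform of the price shifted by `h`, that is, `e^{qh}`
  -- times the tail of the Laplace integral beyond `h`.
  have hstep : ∀ h : ℝ≥0, ∑ y, ((P z).real {ω | Y h ω = y} : ℂ) * w y =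
      Complex.exp (q * ((h : ℝ) : ℂ)) * (w z - ∫ t in (0 : ℝ)..h, u t) := fun h => by
    have e1 : w z - ∫ t in (0 : ℝ)..h, u t = ∫ t in Set.Ioi (h : ℝ), u t := by
      have := intervalIntegral.integral_interval_add_Ioi (f := u) (a := 0) (b := h)
        (by simpa using hint 0) (hint h)
      rw [sub_eq_iff_eq_add', this]
      rfl
    rw [e1, setIntegral_Ioi_laplaceIntegrand, ← mul_assoc, ← Complex.exp_add, neg_mul,
      add_neg_cancel, Complex.exp_zero, one_mul]
    simp only [hY.europeanPrice_add f h, hw, laplaceTransform, ← integral_const_mul]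
    rw [← integral_finsetSum _ fun y _ =>
      (hY.integrableOn_laplace_europeanPrice f hq y).integrable.const_mul _]
    congr 1
    ext t
    simp only [laplaceIntegrand, Complex.ofReal_sum, Finset.mul_sum, Complex.ofReal_mul]
    refine Finset.sum_congr rfl fun y _ => ?_
    ring
  have hcoe : Tendsto (fun h : ℝ≥0 => (h : ℝ)) (𝓝[>] 0) (𝓝[>] 0) := by
    refine tendsto_nhdsWithin_iff.2 ⟨?_, ?_⟩
    · exact (NNReal.continuous_coe.tendsto' 0 0 rfl).mono_left nhdsWithin_le_nhds
    · filter_upwards [self_mem_nhdsWithin] with h hh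
      exact hh
  have hL : Tendsto (fun h : ℝ≥0 => ∑ y, ((((P z).real {ω | Y h ω = y} -
      (if z = y then 1 else 0)) / (h : ℝ) : ℝ) : ℂ) * w y) (𝓝[>] 0)
      (𝓝 (∑ y, (G z y : ℂ) * w y)) := by
    refine tendsto_finsetSum _ fun y _ => Tendsto.mul_const _ ?_
    exact (Complex.continuous_ofReal.tendsto _).comp (hY.rate z y)
  have hE : HasDerivAt (fun t : ℝ => Complex.exp (q * (t : ℂ))) q 0 := by
    have h := ((Complex.ofRealCLM.hasDerivAt (x := (0 : ℝ))).const_mul q).cexp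
    simpa using h
  have hu0 : u 0 = (f z : ℂ) := by
    have := eq_of_tendsto_nhds (hY.tendsto_europeanPrice_zero f z)
    simp [hu, laplaceIntegrand, this]
  have hcont : ContinuousWithinAt u (Set.Ioi 0) 0 := by
    have h1 : Tendsto (fun t : ℝ => Complex.exp (-q * (t : ℂ))) (𝓝 0) (𝓝 1) := by
      have hc : Continuous fun t : ℝ => Complex.exp (-q * (t : ℂ)) := by fun_prop
      exact hc.tendsto' _ _ (by simp)
    have h2 : Tendsto (fun t : ℝ => europeanPrice P Y f t.toNNReal z) (𝓝 0) (𝓝 (f z)) :=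
      (hY.tendsto_europeanPrice_zero f z).comp
        (continuous_real_toNNReal.tendsto' 0 0 Real.toNNReal_zero)
    have h3 := h1.mul ((Complex.continuous_ofReal.tendsto _).comp h2)
    rw [one_mul, ← hu0] at h3
    exact h3.mono_left nhdsWithin_le_nhds
  have hI : HasDerivWithinAt (fun s : ℝ => ∫ t in (0 : ℝ)..s, u t) (f z : ℂ) (Set.Ioi 0) 0 := by
    rw [← hu0]
    have hii : IntervalIntegrable u volume 0 0 := by simp
    refine (intervalIntegral.integral_hasDerivWithinAt_right (s := Set.Ici 0) hii
      ⟨Set.Ioi 0, self_mem_nhdsWithin, ?_⟩ hcont).mono Set.Ioi_subset_Ici_self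
    exact (hY.integrableOn_laplace_europeanPrice f hq z).aestronglyMeasurable
  have hE' := (hasDerivWithinAt_iff_tendsto_slope' (Set.notMem_Ioi.2 le_rfl)).1
    (hE.hasDerivWithinAt (s := Set.Ioi 0))
  have hI' := (hasDerivWithinAt_iff_tendsto_slope' (Set.notMem_Ioi.2 le_rfl)).1 hI
  have hE0 : Tendsto (fun t : ℝ => Complex.exp (q * (t : ℂ))) (𝓝[>] 0) (𝓝 1) := by
    have := hE.continuousAt.tendsto.mono_left (nhdsWithin_le_nhds (s := Set.Ioi 0))
    simpa using this
  -- The difference quotient of `e^{qh} (w z - ∫₀^h u)`, split as `((e^{qh} - 1)/h) w z - e^{qh}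
  -- (1/h) ∫₀^h u`; its limit is `q w z - f z`.
  have hR := ((hE'.mul_const (w z)).sub (hE0.mul hI')).comp hcoe
  rw [one_mul] at hR
  refine sub_eq_iff_eq_add.2 (sub_eq_iff_eq_add'.1 (tendsto_nhds_unique (hR.congr' ?_) hL))
  filter_upwards [self_mem_nhdsWithin] with h hh
  have hh0 : ((h : ℝ) : ℂ) ≠ 0 := by
    have : (h : ℝ) ≠ 0 := NNReal.coe_ne_zero.2 (ne_of_gt hh)
    exact_mod_cast this
  have e2 : ∑ y, ((((P z).real {ω | Y h ω = y} -
      (if z = y then 1 else 0)) / (h : ℝ) : ℝ) : ℂ) * w y =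
      (∑ y, ((P z).real {ω | Y h ω = y} : ℂ) * w y - w z) / ((h : ℝ) : ℂ) := by
    have : w z = ∑ y, (if z = y then (1 : ℂ) else 0) * w y := by simp
    rw [this, ← Finset.sum_sub_distrib, Finset.sum_div]
    refine Finset.sum_congr rfl fun y _ => ?_
    split_ifs <;> push_cast <;> ring
  rw [e2, hstep]
  simp only [Function.comp, slope_def_module, sub_zero, Complex.real_smul,
    intervalIntegral.integral_same, Complex.ofReal_zero, mul_zero, Complex.exp_zero]
  push_cast
  field_simp
  ring

/-- Column `y` is the linear system for the payoff that is the indicator of `y`. A one-sided inverse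
of a square matrix over a field is two-sided, which gives invertibility. -/
theorem resolvent_mul_eq_one (hY : IsCTMC G P Y) {q : ℂ} (hq : 0 < q.re) :
    (q • (1 : Matrix S S ℂ) - G.map (fun r : ℝ => (r : ℂ))) *
      Matrix.of (fun z y : S => laplaceTransform
        (fun t => europeanPrice P Y (Pi.single y 1) t z) q) = 1 := by
  ext z y
  have h := hY.laplaceTransform_europeanPrice_linear_system (Pi.single y 1) hq z
  rw [sub_mul, Matrix.smul_mul, one_mul, Matrix.sub_apply, Matrix.smul_apply, Matrix.mul_apply]
  simp only [Matrix.of_apply, Matrix.map_apply, smul_eq_mul]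
  rw [h, Matrix.one_apply, Pi.single_apply]
  split_ifs <;> simp

theorem isUnit_resolvent (hY : IsCTMC G P Y) {q : ℂ} (hq : 0 < q.re) :
    IsUnit (q • (1 : Matrix S S ℂ) - G.map (fun r : ℝ => (r : ℂ))) :=
  IsUnit.of_mul_eq_one _ (hY.resolvent_mul_eq_one hq)

theorem laplaceTransform_europeanPrice_eq (hY : IsCTMC G P Y) (f : S → ℝ) {q : ℂ}
    (hq : 0 < q.re) :
    (fun z : S => laplaceTransform (fun t => europeanPrice P Y f t z) q) =
      (q • (1 : Matrix S S ℂ) - G.map (fun r : ℝ => (r : ℂ)))⁻¹.mulVec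
        (fun z : S => (f z : ℂ)) := by
  have hA := hY.isUnit_resolvent hq
  have h : (q • (1 : Matrix S S ℂ) - G.map (fun r : ℝ => (r : ℂ))).mulVec
      (fun z : S => laplaceTransform (fun t => europeanPrice P Y f t z) q) =
        fun z : S => (f z : ℂ) := by
    ext z
    rw [← hY.laplaceTransform_europeanPrice_linear_system f hq z, Matrix.sub_mulVec,
      Matrix.smul_mulVec, Matrix.one_mulVec]
    simp [Matrix.mulVec, dotProduct]
  rw [← h, Matrix.mulVec_mulVec, Matrix.nonsing_inv_mul _ ((Matrix.isUnit_iff_isUnit_det _).1 hA),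
    Matrix.one_mulVec]

end IsCTMC
-- The pricing formula.
theorem mainTheorem5 {S : Finset ℝ} {Ω : Type*} [MeasurableSpace Ω]
    (G : Matrix S S ℝ) (P : S → Measure Ω) (Y : ℝ≥0 → Ω → S) (hY : IsCTMC G P Y)
    (L D : ℝ) (hD : 0 < D) (f : S → ℝ) (q : ℂ) (hq : 0 < q.re) :
    -- all expectations and Laplace integrals below converge absolutely
    ((∀ (x : S) (t : ℝ≥0), Integrable (downInPayoff L D Y f t) (P x)) ∧
      (∀ x z : S, Integrable (discountedHit L D Y q z) (P x)) ∧
      (∀ (z : S) (t : ℝ≥0), Integrable (fun ω => f (Y t ω)) (P z)) ∧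
      (∀ x : S, IntegrableOn (laplaceIntegrand (fun t => downInPrice P Y L D f t x) q)
        (Set.Ioi 0)) ∧
      (∀ z : S, IntegrableOn (laplaceIntegrand (fun t => europeanPrice P Y f t z) q)
        (Set.Ioi 0))) ∧
    -- the representation of the Laplace transform of the Parisian price
    (∀ x : S, laplaceTransform (fun t => downInPrice P Y L D f t x) q =
      ∑ z ∈ (Finset.univ : Finset S).filter (fun z : S => (z : ℝ) < L), parisianTransform P Y L D q x z *
        laplaceTransform (fun t => europeanPrice P Y f t z) q) ∧
    -- the linear system for the Laplace transform of the European price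
    (∀ z : S, q * laplaceTransform (fun t => europeanPrice P Y f t z) q -
      ∑ y : S, (G z y : ℂ) * laplaceTransform (fun t => europeanPrice P Y f t y) q = (f z : ℂ)) ∧
    -- the same in matrix form: `q I - G` is invertible and the transform is `(q I - G)⁻¹ f`
    IsUnit (q • (1 : Matrix S S ℂ) - G.map (fun r : ℝ => (r : ℂ))) ∧
    (fun z : S => laplaceTransform (fun t => europeanPrice P Y f t z) q) =
      (q • (1 : Matrix S S ℂ) - G.map (fun r : ℝ => (r : ℂ)))⁻¹.mulVec
        (fun z : S => (f z : ℂ)) := by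
  refine ⟨⟨fun x t => hY.integrable_downInPayoff L hD f x t,
    fun x z => hY.integrable_discountedHit L hD hq x z,
    fun z t => hY.integrable_comp f z t,
    fun x => hY.integrableOn_laplace_downInPrice L hD f hq x,
    fun z => hY.integrableOn_laplace_europeanPrice f hq z⟩,
    fun x => ?_, fun z => hY.laplaceTransform_europeanPrice_linear_system f hq z,
    hY.isUnit_resolvent hq, hY.laplaceTransform_europeanPrice_eq f hq⟩
  rw [hY.laplaceTransform_downInPrice L hD f hq x]
  -- The sum over all states reduces to `z < L`, since a nonzero term needs a nonzero
  -- `parisianTransform`.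
  refine (Finset.sum_filter_of_ne fun z _ hz => ?_).symm
  by_contra hL
  exact hz (by rw [hY.parisianTransform_eq_zero hD q x hL, zero_mul])
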